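/- A graph history $\mathcal G=\{G_1,\dots,G_\tau\}$ ($\tau\ge 1$) is a collection of $\tau$ finite simple undirected graphs $G_t=(V,E_t)$ over the same nonempty set of nodes $V=\{0,\dots,n-1\}$. For a nonempty set $S\subseteq V$ let $G_t[S]=(S,E_t(S))$ be the induced subgraph, let $$d_a(S,G_t)=\frac1{|S|}\sum_{u\in S}\mathrm{degree}(u,G_t[S])=\frac{2|E_t(S)|}{|S|}$$ be its average degree, and let $$f_{aa}(S,\mathcal G)=\frac1\tau\sum_{t=1}^{\tau}d_a(S,G_t).$$ The problem BFF-aa asks, given $\mathcal G$, for a nonempty set of nodes $S\subseteq V$ that maximizes $f_{aa}(S,\mathcal G)$ over all nonempty subsets of $V$. **Proposition.** The BFF-aa problem can be solved optimally in polynomial time: there are a single program and a polynomial $p$ such that, for all $n,\tau\ge 1$ and every graph history $\mathcal G$ of $\tau$ snapshots on $n$ nodes, the program, run on the bit string of length $N$ that consists of $n$ and $\tau$ in unary and the adjacency matrices of the snapshots, halts after at most $p(N)$ steps and outputs the characteristic vector of an optimal solution $S$. (Programs are those of a random-access machine with registers and arrays of natural numbers, with addition and truncated subtraction as the only arithmetic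 operations, and with unit cost for every operation.) -/

import Mathlib

/-! ## Graph histories and their aggregate density -/

/-- A graph history: a collection of `τ` undirected graph snapshots over the same set of nodes `V`
(the snapshots need not be distinct). -/
structure GraphHistory (V : Type*) (τ : ℕ) where
  /-- the `t`-th snapshot -/
  snapshot : Fin τ → SimpleGraph V

open Classical in
/-- The average density `d_a(G)` of a graph `G`: the average degree of its nodes. -/
noncomputable def avgDensity {V : Type*} [Fintype V] (G : SimpleGraph V) : ℚ :=
  (∑ u : V, (G.degree u : ℚ)) / (Fintype.card V : ℚ)

/-- The average density `d_a(S, G) = d_a(G[S])` of a set of nodes `S`: the average density of the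
subgraph of `G` induced by `S`. -/
noncomputable def avgDensityOn {V : Type*} (G : SimpleGraph V) (S : Finset V) : ℚ :=
  avgDensity (G.induce (S : Set V))

namespace GraphHistory

/-- The aggregate density `f_aa(S, 𝒢)`: the average over all snapshots of the average density
of `S`. -/
noncomputable def faa {V : Type*} {τ : ℕ} (𝒢 : GraphHistory V τ) (S : Finset V) : ℚ :=
  (∑ t : Fin τ, avgDensityOn (𝒢.snapshot t) S) / (τ : ℚ)

/-- `S` is an optimal solution of the BFF-aa problem on `𝒢`: it maximizes `f_aa(·, 𝒢)` over all
nonempty sets of nodes. -/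
def IsOptimalAA {V : Type*} {τ : ℕ} (𝒢 : GraphHistory V τ) (S : Finset V) : Prop :=
  S.Nonempty ∧ ∀ T : Finset V, T.Nonempty → 𝒢.faa T ≤ 𝒢.faa S

open Classical in
/-- The bit string that describes a graph history on the nodes `0, …, n - 1`: the numbers `n` and
`τ` in unary, each closed by a `false`, then the `τ` adjacency matrices, row by row. -/
noncomputable def encode {n τ : ℕ} (𝒢 : GraphHistory (Fin n) τ) : List Bool :=
  List.replicate n true ++ [false] ++ (List.replicate τ true ++ [false]) ++
    (List.finRange τ).flatMap fun t =>
      (List.finRange n).flatMap fun i =>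
        (List.finRange n).map fun j => decide ((𝒢.snapshot t).Adj i j)

end GraphHistory

/-- The bit string that describes a set of nodes among `0, …, n - 1`: its characteristic
vector. -/
def encodeNodes {n : ℕ} (S : Finset (Fin n)) : List Bool :=
  (List.finRange n).map fun i => decide (i ∈ S)

/-! ## A random-access machine with a step count

A program uses finitely many registers and finitely many one-way infinite arrays, all of them
holding natural numbers. Its only arithmetic operations are addition and truncated subtraction.
Every elementary operation costs one unit; as one operation lengthens the largest stored number by
at most one bit, a run of length `T` is simulated by a Turing machine in time polynomial in `T` and
the length of the input, and conversely. -/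

namespace RAM

/-- The state of the memory: register `x` holds `reg x`, cell `i` of array `a` holds `arr a i`. -/
structure Memory where
  /-- the contents of the registers -/
  reg : ℕ → ℕ
  /-- the contents of the arrays -/
  arr : ℕ → ℕ → ℕ

namespace Memory

/-- Write `v` into register `x`. -/
def setReg (s : Memory) (x v : ℕ) : Memory :=
  { s with reg := Function.update s.reg x v }

/-- Write `v` into cell `i` of array `a`. -/
def setArr (s : Memory) (a i v : ℕ) : Memory :=
  { s with arr := Function.update s.arr a (Function.update (s.arr a) i v) }

/-- The initial memory on the input `w`: the length of `w` is in register `0` and the bits of `w`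
are in array `0`; everything else is `0`. -/
def init (w : List Bool) : Memory where
  reg x := if x = 0 then w.length else 0
  arr a i := if a = 0 then (w.getD i false).toNat else 0

/-- The memory `s` holds the output `w`: the length of `w` is in register `0` and the bits of `w`
are at the beginning of array `1`. -/
def HoldsOutput (s : Memory) (w : List Bool) : Prop :=
  s.reg 0 = w.length ∧ ∀ i, i < w.length → s.arr 1 i = (w.getD i false).toNat

end Memory

/-- Arithmetic terms. -/
inductive Term where
  /-- a constant -/
  | const (c : ℕ) : Term
  /-- the contents of a register -/
  | reg (x : ℕ) : Term
  /-- the contents of a cell of an array, at a computed address -/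
  | load (a : ℕ) (e : Term) : Term
  /-- addition -/
  | add (e f : Term) : Term
  /-- truncated subtraction -/
  | sub (e f : Term) : Term

namespace Term

/-- The value of a term. -/
def eval (s : Memory) : Term → ℕ
  | const c => c
  | reg x => s.reg x
  | load a e => s.arr a (e.eval s)
  | add e f => e.eval s + f.eval s
  | sub e f => e.eval s - f.eval s

/-- The cost of evaluating a term: one unit for every operation in it. -/
def cost : Term → ℕ
  | const _ => 1
  | reg _ => 1
  | load _ e => e.cost + 1
  | add e f => e.cost + f.cost + 1
  | sub e f => e.cost + f.cost + 1

end Term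

/-- Programs. -/
inductive Program where
  /-- do nothing -/
  | skip : Program
  /-- write the value of `e` into register `x` -/
  | assign (x : ℕ) (e : Term) : Program
  /-- write the value of `e` into array `a`, at the address that is the value of `i` -/
  | store (a : ℕ) (i e : Term) : Program
  /-- run `p`, then `q` -/
  | seq (p q : Program) : Program
  /-- run `p` if the value of `e` is not `0`, and `q` otherwise -/
  | cond (e : Term) (p q : Program) : Program
  /-- as long as the value of `e` is not `0`, run `p` -/
  | loop (e : Term) (p : Program) : Program

/-- `Exec p s s' k`: the program `p`, started in the memory `s`, halts in the memory `s'` after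
`k` steps. -/
inductive Exec : Program → Memory → Memory → ℕ → Prop where
  | skip (s : Memory) : Exec .skip s s 1
  | assign (s : Memory) (x : ℕ) (e : Term) :
      Exec (.assign x e) s (s.setReg x (e.eval s)) (e.cost + 1)
  | store (s : Memory) (a : ℕ) (i e : Term) :
      Exec (.store a i e) s (s.setArr a (i.eval s) (e.eval s)) (i.cost + e.cost + 1)
  | seq {p q : Program} {s s' s'' : Memory} {k l : ℕ} :
      Exec p s s' k → Exec q s' s'' l → Exec (.seq p q) s s'' (k + l)
  | cond_true {e : Term} {p q : Program} {s s' : Memory} {k : ℕ} :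
      e.eval s ≠ 0 → Exec p s s' k → Exec (.cond e p q) s s' (e.cost + 1 + k)
  | cond_false {e : Term} {p q : Program} {s s' : Memory} {k : ℕ} :
      e.eval s = 0 → Exec q s s' k → Exec (.cond e p q) s s' (e.cost + 1 + k)
  | loop_true {e : Term} {p : Program} {s s' s'' : Memory} {k l : ℕ} :
      e.eval s ≠ 0 → Exec p s s' k → Exec (.loop e p) s' s'' l →
        Exec (.loop e p) s s'' (e.cost + 1 + k + l)
  | loop_false {e : Term} {p : Program} {s : Memory} :
      e.eval s = 0 → Exec (.loop e p) s s (e.cost + 1)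

/-- On the input `w`, the program `p` halts after at most `T` steps, with the output `v`. -/
def Program.OutputsInTime (p : Program) (w v : List Bool) (T : ℕ) : Prop :=
  ∃ (s : Memory) (k : ℕ), Exec p (Memory.init w) s k ∧ k ≤ T ∧ s.HoldsOutput v

end RAM

/-! All snapshots share the denominator `|S|`, so maximizing `f_aa` is the densest-subgraph problem
for one graph whose pair weights count snapshots (`faa_eq`). The proof uses its LP dual: split each
pair's weight between its two endpoints so as to keep the loads small. The largest load bounds the
density of every set (`sum_weight_le`).

Local search over integral splits moves one unit downhill as long as two endpoints differ in load by
at least 2; the sum of squared loads drops with each move. In the final split, take the largest load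
`L` and descend to a threshold `c` such that every value from `c` to `L` is a load and `c - 1` is
not. No share of a vertex of load at least `c` lies on a pair leaving the set `S` of these vertices,
so the load average `c` is reached inside `S` (`le_sum_weight`), while `L - c < n` by pigeonhole.

The bounds thus differ by less than `n`. With all weights scaled by `2k`, `k ≥ n ^ 3`, this is less
than the smallest possible gap between two distinct densities, so `S` is exactly optimal
(`densest`). Taking `k = N ^ 2` suffices and keeps all loads polynomial in `N`, so unit moves are
affordable. -/

/-! ## Distributing edge weights among the endpoints -/

/-- The weight `w i j` of every pair is split between its two endpoints, `M i j` going to `i`;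
`l i` is the total load of `i`. -/
structure IsLoadSplit {V : Type*} [Fintype V] (w M : V → V → ℕ) (l : V → ℕ) : Prop where
  pair : ∀ i j, M i j + M j i = w i j
  load : ∀ i, l i = ∑ j, M i j

namespace IsLoadSplit

variable {V : Type*} [Fintype V] {w M M' : V → V → ℕ} {l l' : V → ℕ}

theorem sum_weight (h : IsLoadSplit w M l) (T : Finset V) :
    ∑ i ∈ T, ∑ j ∈ T, w i j = 2 * ∑ i ∈ T, ∑ j ∈ T, M i j := by
  simp_rw [← h.pair, Finset.sum_add_distrib]
  rw [Finset.sum_comm (f := fun i j => M j i), two_mul]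

/-- Weak duality: the weight inside `T` is paid for by the loads of its vertices. -/
theorem sum_weight_le (h : IsLoadSplit w M l) {L : ℕ} (hL : ∀ i, l i ≤ L) (T : Finset V) :
    ∑ i ∈ T, ∑ j ∈ T, w i j ≤ 2 * (L * T.card) := by
  rw [h.sum_weight]
  gcongr
  calc ∑ i ∈ T, ∑ j ∈ T, M i j ≤ ∑ i ∈ T, L := by
        refine Finset.sum_le_sum fun i _ => le_trans ?_ (hL i)
        rw [h.load]
        exact Finset.sum_le_sum_of_subset (Finset.subset_univ T)
    _ = L * T.card := by simp [mul_comm]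

/-- If no load can be moved downhill and no vertex has load `c - 1`, then the vertices of load at
least `c` keep all of their load among themselves. -/
theorem le_sum_weight (h : IsLoadSplit w M l) (hbal : ∀ a b, M a b ≠ 0 → l a ≤ l b + 1) {c : ℕ}
    (hc : ∀ i, l i + 1 ≠ c) (S : Finset V) (hS : ∀ i, i ∈ S ↔ c ≤ l i) :
    2 * (c * S.card) ≤ ∑ i ∈ S, ∑ j ∈ S, w i j := by
  rw [h.sum_weight]
  gcongr
  calc c * S.card = ∑ i ∈ S, c := by simp [mul_comm]
    _ ≤ ∑ i ∈ S, ∑ j ∈ S, M i j := by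
      refine Finset.sum_le_sum fun i hi => ((hS i).1 hi).trans ?_
      rw [h.load]
      -- If `M i j ≠ 0` with `j` outside `S`, balance forces `l j = c - 1`, which is excluded.
      refine (Finset.sum_subset (Finset.subset_univ S) fun j _ hj => ?_).ge
      by_contra h0
      have h1 := hbal i j h0
      have h2 := (hS i).1 hi
      have h3 := hc j
      rw [hS] at hj
      omega

/-- A threshold set of a locally balanced split is a densest set, provided that all weights are
multiples of a large number. -/
theorem densest {k : ℕ} {e : V → V → ℕ} (h : IsLoadSplit (fun i j => 2 * (k * e i j)) M l)
    (hk : Fintype.card V ^ 3 ≤ k)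
    (hbal : ∀ a b, M a b ≠ 0 → l a ≤ l b + 1) {c L : ℕ} (hL : ∀ i, l i ≤ L)
    (hcL : ∀ x, c ≤ x → x ≤ L → ∃ i, l i = x)
    (hc : ∀ i, l i + 1 ≠ c) (S : Finset V) (hS : ∀ i, i ∈ S ↔ c ≤ l i)
    (T : Finset V) (hT : T.Nonempty) :
    (∑ i ∈ T, ∑ j ∈ T, e i j) * S.card ≤ (∑ i ∈ S, ∑ j ∈ S, e i j) * T.card := by
  classical
  have h1 := h.sum_weight_le hL T
  have h2 := h.le_sum_weight hbal hc S hS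
  simp_rw [← Finset.mul_sum] at h1 h2
  have h1 := Nat.le_of_mul_le_mul_left h1 two_pos
  have h2 := Nat.le_of_mul_le_mul_left h2 two_pos
  -- Pigeonhole: each of the values `c, …, L` is the load of some vertex.
  have hLc : L + 1 - c ≤ Fintype.card V := by
    rw [← Nat.card_Icc, ← Finset.card_univ]
    refine le_trans (Finset.card_le_card (t := Finset.univ.image l) fun x hx => ?_)
      Finset.card_image_le
    rw [Finset.mem_Icc] at hx
    obtain ⟨i, hi⟩ := hcL x hx.1 hx.2
    exact Finset.mem_image.2 ⟨i, Finset.mem_univ i, hi⟩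
  obtain ⟨v, hv⟩ := hT
  set n := Fintype.card V
  have hn : 0 < n := Fintype.card_pos_iff.2 ⟨v⟩
  have hSn : S.card ≤ n := Finset.card_le_univ S
  have hTn : T.card ≤ n := Finset.card_le_univ T
  set E := ∑ i ∈ T, ∑ j ∈ T, e i j
  set D := ∑ i ∈ S, ∑ j ∈ S, e i j
  have hkpos : 0 < k := lt_of_lt_of_le (by positivity) hk
  have hsmall : (n - 1) * (T.card * S.card) < k := by
    calc (n - 1) * (T.card * S.card) ≤ (n - 1) * (n * n) := by gcongr
      _ < n * (n * n) := by
        apply Nat.mul_lt_mul_of_pos_right (by omega) (by positivity)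
      _ = n ^ 3 := by ring
      _ ≤ k := hk
  have hLn : L ≤ c + (n - 1) := by omega
  -- The total error stays below `k`, so after division by `k` integrality removes it.
  have : k * (E * S.card) < k * (D * T.card + 1) := by
    calc k * (E * S.card) = k * E * S.card := by ring
      _ ≤ L * T.card * S.card := by gcongr
      _ ≤ (c + (n - 1)) * T.card * S.card := by gcongr
      _ = c * S.card * T.card + (n - 1) * (T.card * S.card) := by ring
      _ ≤ k * D * T.card + (n - 1) * (T.card * S.card) := by gcongr
      _ < k * D * T.card + k := by gcongr
      _ = k * (D * T.card + 1) := by ring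
  exact Nat.lt_succ_iff.1 (lt_of_mul_lt_mul_left this (Nat.zero_le k))

/-! ### Unit moves and their potential -/

variable {a b : V}

/-- Moving one unit of the weight of `a, b` from `a` to `b` gives another split. -/
theorem move (h : IsLoadSplit w M l) (hab : a ≠ b) (h1 : M' a b + 1 = M a b)
    (h2 : M' b a = M b a + 1)
    (h3 : ∀ i j, ¬(i = a ∧ j = b) → ¬(i = b ∧ j = a) → M' i j = M i j)
    (h4 : l' a + 1 = l a) (h5 : l' b = l b + 1) (h6 : ∀ i, i ≠ a → i ≠ b → l' i = l i) :
    IsLoadSplit w M' l' where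
  pair i j := by
    rw [← h.pair]
    by_cases hi : i = a ∧ j = b
    · obtain ⟨rfl, rfl⟩ := hi
      omega
    by_cases hj : i = b ∧ j = a
    · obtain ⟨rfl, rfl⟩ := hj
      omega
    rw [h3 i j hi hj, h3 j i (by tauto) (by tauto)]
  load i := by
    classical
    have key := h.load i
    by_cases ha : i = a
    · subst ha
      have hs : ∑ j ∈ Finset.univ.erase b, M' i j = ∑ j ∈ Finset.univ.erase b, M i j :=
        Finset.sum_congr rfl fun j hj => h3 i j (by grind) (by grind)
      rw [← Finset.add_sum_erase _ _ (Finset.mem_univ b)] at key ⊢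
      omega
    by_cases hb : i = b
    · subst hb
      have hs : ∑ j ∈ Finset.univ.erase a, M' i j = ∑ j ∈ Finset.univ.erase a, M i j :=
        Finset.sum_congr rfl fun j hj => h3 i j (by grind) (by grind)
      rw [← Finset.add_sum_erase _ _ (Finset.mem_univ a)] at key ⊢
      omega
    rw [h6 i ha hb, key]
    exact Finset.sum_congr rfl fun j _ => (h3 i j (by tauto) (by tauto)).symm

end IsLoadSplit

/-- Moving one unit downhill decreases the sum of the squares. -/
theorem sum_sq_lt_of_move {V : Type*} [Fintype V] {l l' : V → ℕ} {a b : V} (hlt : l b + 2 ≤ l a)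
    (h4 : l' a + 1 = l a) (h5 : l' b = l b + 1) (h6 : ∀ i, i ≠ a → i ≠ b → l' i = l i) :
    ∑ i, l' i ^ 2 < ∑ i, l i ^ 2 := by
  classical
  have hab : b ∈ Finset.univ.erase a := by
    simp only [Finset.mem_erase, Finset.mem_univ, and_true]
    rintro rfl
    omega
  rw [← Finset.add_sum_erase _ (fun i => l' i ^ 2) (Finset.mem_univ a),
    ← Finset.add_sum_erase _ _ hab, ← Finset.add_sum_erase _ (fun i => l i ^ 2) (Finset.mem_univ a),
    ← Finset.add_sum_erase _ (fun i => l i ^ 2) hab,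
    Finset.sum_congr rfl fun j hj => congrArg (· ^ 2) (h6 j (by grind) (by grind))]
  -- After cancellation the claim is `2 * l b < 2 * l' a`.
  rw [← h4, h5]
  nlinarith

/-! ## The aggregate density in terms of pair weights -/

open Classical in
theorem avgDensityOn_eq {V : Type*} (G : SimpleGraph V) (S : Finset V) :
    avgDensityOn G S = ((∑ i ∈ S, ∑ j ∈ S, if G.Adj i j then 1 else 0 : ℕ) : ℚ) / S.card := by
  unfold avgDensityOn avgDensity
  congr 1
  · push_cast
    rw [← Finset.sum_coe_sort S]
    refine Finset.sum_congr rfl fun u _ => ?_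
    rw [← Finset.sum_coe_sort S, SimpleGraph.degree, SimpleGraph.neighborFinset_eq_filter]
    simp only [Finset.card_filter, SimpleGraph.comap_adj, Function.Embedding.subtype_apply]
    push_cast
    rfl
  · simp

namespace GraphHistory

open Classical in
/-- The number of snapshots in which `i` and `j` are adjacent. -/
noncomputable def weight {V : Type*} {τ : ℕ} (𝒢 : GraphHistory V τ) (i j : V) : ℕ :=
  ∑ t, if (𝒢.snapshot t).Adj i j then 1 else 0

theorem weight_comm {V : Type*} {τ : ℕ} (𝒢 : GraphHistory V τ) (i j : V) :
    𝒢.weight i j = 𝒢.weight j i := by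
  classical
  exact Finset.sum_congr rfl fun t _ => if_congr ((𝒢.snapshot t).adj_comm i j) rfl rfl

theorem weight_le {V : Type*} {τ : ℕ} (𝒢 : GraphHistory V τ) (i j : V) :
    𝒢.weight i j ≤ τ := by
  classical
  rw [weight, ← Finset.card_filter]
  exact (Finset.card_le_univ _).trans (by simp)

/-- The common denominator lets the sum over snapshots be taken inside, giving a single weighted
graph. -/
theorem faa_eq {V : Type*} {τ : ℕ} (𝒢 : GraphHistory V τ) (S : Finset V) :
    𝒢.faa S = ((∑ i ∈ S, ∑ j ∈ S, 𝒢.weight i j : ℕ) : ℚ) / S.card / τ := by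
  unfold faa weight
  simp_rw [avgDensityOn_eq, ← Finset.sum_div]
  congr 2
  push_cast
  rw [Finset.sum_comm]
  refine Finset.sum_congr rfl fun i _ => ?_
  rw [Finset.sum_comm]

theorem isOptimalAA_of_densest {V : Type*} {τ : ℕ} (𝒢 : GraphHistory V τ) {S : Finset V}
    (hS : S.Nonempty)
    (h : ∀ T : Finset V, T.Nonempty → (∑ i ∈ T, ∑ j ∈ T, 𝒢.weight i j) * S.card ≤
      (∑ i ∈ S, ∑ j ∈ S, 𝒢.weight i j) * T.card) : 𝒢.IsOptimalAA S := by
  refine ⟨hS, fun T hT => ?_⟩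
  rw [faa_eq, faa_eq]
  have h1 : (0 : ℚ) < S.card := by exact_mod_cast hS.card_pos
  have h2 : (0 : ℚ) < T.card := by exact_mod_cast hT.card_pos
  gcongr ?_ / _
  rw [div_le_div_iff₀ h2 h1]
  exact_mod_cast h T hT

end GraphHistory

/-! ## The input string -/

theorem List.length_flatMap_of_length_eq {α β : Type*} {m : ℕ} (L : List α) (f : α → List β)
    (hf : ∀ a, (f a).length = m) : (L.flatMap f).length = L.length * m := by
  simp [List.length_flatMap, hf]

theorem List.getD_flatMap_of_length_eq {α β : Type*} {m : ℕ} (L : List α) (f : α → List β)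
    (hf : ∀ a, (f a).length = m) (d : β) {t x : ℕ} (ht : t < L.length) (hx : x < m) :
    (L.flatMap f).getD (t * m + x) d = (f L[t]).getD x d := by
  induction L generalizing t with
  | nil => simp at ht
  | cons a L ih =>
    rw [List.flatMap_cons]
    cases t with
    | zero =>
      rw [List.getD_append _ _ _ _ (by rw [hf]; omega)]
      simp
    | succ t =>
      rw [List.getD_append_right _ _ _ _ (by rw [hf, Nat.succ_mul]; omega), hf,
        show (t + 1) * m + x - m = t * m + x by rw [Nat.succ_mul]; omega,
        ih (by simpa using ht)]
      simp

namespace GraphHistory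

variable {n τ : ℕ} (𝒢 : GraphHistory (Fin n) τ)

theorem length_encode : 𝒢.encode.length = n + 1 + τ + 1 + τ * (n * n) := by
  classical
  unfold encode
  rw [List.length_append, List.length_flatMap_of_length_eq (m := n * n)]
  · simp
    omega
  · intro t
    rw [List.length_flatMap_of_length_eq (m := n)] <;> simp

theorem getD_encode_of_lt {x : ℕ} (hx : x < n) : 𝒢.encode.getD x false = true := by
  unfold encode
  rw [List.getD_append _ _ _ _ (by simp; omega), List.getD_append _ _ _ _ (by simp; omega),
    List.getD_append _ _ _ _ (by simp; omega)]
  simp [hx]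

theorem getD_encode_nodes : 𝒢.encode.getD n false = false := by
  unfold encode
  rw [List.getD_append _ _ _ _ (by simp), List.getD_append _ _ _ _ (by simp),
    List.getD_append_right _ _ _ _ (by simp)]
  simp

theorem getD_encode_snapshots_of_lt {x : ℕ} (hx : x < τ) :
    𝒢.encode.getD (n + 1 + x) false = true := by
  unfold encode
  rw [List.getD_append _ _ _ _ (by simp; omega), List.getD_append_right _ _ _ _ (by simp),
    List.getD_append _ _ _ _ (by simp; omega)]
  simp [hx]

theorem getD_encode_snapshots : 𝒢.encode.getD (n + 1 + τ) false = false := by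
  unfold encode
  rw [List.getD_append _ _ _ _ (by simp; omega), List.getD_append_right _ _ _ _ (by simp),
    List.getD_append_right _ _ _ _ (by simp)]
  simp

open Classical in
theorem getD_encode_adj (t : Fin τ) (i j : Fin n) :
    𝒢.encode.getD (n + 1 + τ + 1 + (t * (n * n) + (i * n + j))) false =
      decide ((𝒢.snapshot t).Adj i j) := by
  unfold encode
  have hij : (i * n + j : ℕ) < n * n := by nlinarith [i.2, j.2]
  rw [List.getD_append_right _ _ _ _ (by simp; omega)]
  rw [show n + 1 + τ + 1 + (t * (n * n) + (i * n + j)) - (List.replicate n true ++ [false] ++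
      (List.replicate τ true ++ [false])).length = t * (n * n) + (i * n + j) by simp; omega]
  rw [List.getD_flatMap_of_length_eq (m := n * n) _ _ _ _ (by simp) hij]
  · rw [List.getD_flatMap_of_length_eq (m := n) _ _ _ _ (by simp) j.2]
    · simp
    · simp
  · intro t
    rw [List.length_flatMap_of_length_eq (m := n)] <;> simp

end GraphHistory

/-! ## Running programs -/

namespace RAM

/-- The program `p`, started in `s`, halts in `s'` after at most `T` steps. -/
def Program.Runs (p : Program) (s s' : Memory) (T : ℕ) : Prop :=
  ∃ k, Exec p s s' k ∧ k ≤ T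

namespace Program

/-- Programs without loops. -/
def isLoopFree : Program → Bool
  | skip | assign _ _ | store _ _ _ => true
  | seq p q | cond _ p q => p.isLoopFree && q.isLoopFree
  | loop _ _ => false

/-- The effect of a program without loops. -/
def run : Program → Memory → Memory
  | skip, s => s
  | assign x e, s => s.setReg x (e.eval s)
  | store a i e, s => s.setArr a (i.eval s) (e.eval s)
  | seq p q, s => q.run (p.run s)
  | cond e p q, s => if e.eval s = 0 then q.run s else p.run s
  | loop _ _, s => s

/-- A bound for the running time of a program without loops. -/
def size : Program → ℕ
  | skip => 1
  | assign _ e => e.cost + 1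
  | store _ i e => i.cost + e.cost + 1
  | seq p q => p.size + q.size
  | cond e p q => e.cost + 1 + (p.size + q.size)
  | loop _ _ => 0

theorem runs_run {p : Program} (hp : p.isLoopFree = true) (s : Memory) :
    p.Runs s (p.run s) p.size := by
  induction p generalizing s with
  | skip => exact ⟨_, .skip s, le_rfl⟩
  | assign x e => exact ⟨_, .assign s x e, le_rfl⟩
  | store a i e => exact ⟨_, .store s a i e, le_rfl⟩
  | seq p q hp' hq' =>
    rw [isLoopFree, Bool.and_eq_true] at hp
    obtain ⟨k, hk, hk'⟩ := hp' hp.1 s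
    obtain ⟨l, hl, hl'⟩ := hq' hp.2 (p.run s)
    exact ⟨_, .seq hk hl, Nat.add_le_add hk' hl'⟩
  | cond e p q hp' hq' =>
    rw [isLoopFree, Bool.and_eq_true] at hp
    obtain ⟨k, hk, hk'⟩ := hp' hp.1 s
    obtain ⟨l, hl, hl'⟩ := hq' hp.2 s
    rw [run, size]
    split_ifs with h
    · exact ⟨_, .cond_false h hl, by omega⟩
    · exact ⟨_, .cond_true h hk, by omega⟩
  | loop => simp [isLoopFree] at hp

theorem Runs.seq {p q : Program} {s s' s'' : Memory} {T U : ℕ} (hp : p.Runs s s' T)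
    (hq : q.Runs s' s'' U) : (Program.seq p q).Runs s s'' (T + U) := by
  obtain ⟨k, hk, hk'⟩ := hp
  obtain ⟨l, hl, hl'⟩ := hq
  exact ⟨_, .seq hk hl, Nat.add_le_add hk' hl'⟩

theorem Runs.mono {p : Program} {s s' : Memory} {T U : ℕ} (hp : p.Runs s s' T) (h : T ≤ U) :
    p.Runs s s' U := by
  obtain ⟨k, hk, hk'⟩ := hp
  exact ⟨k, hk, hk'.trans h⟩

theorem runs_of_run_eq {p : Program} {s s' : Memory} {T : ℕ} (hp : p.isLoopFree = true)
    (hs : p.run s = s') (hT : p.size ≤ T) : p.Runs s s' T :=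
  hs ▸ (runs_run hp s).mono hT

/-- A loop whose body preserves the invariant `I` and decreases the measure `μ`. -/
theorem exists_runs_loop {σ : Type*} (F : σ → Memory) (I : σ → Prop) (μ : σ → ℕ) {e : Term}
    {p : Program} {T : ℕ}
    (h : ∀ x, I x → e.eval (F x) ≠ 0 → ∃ y, I y ∧ μ y < μ x ∧ p.Runs (F x) (F y) T)
    (x : σ) (hx : I x) :
    ∃ y, I y ∧ e.eval (F y) = 0 ∧
      (loop e p).Runs (F x) (F y) (μ x * (e.cost + 1 + T) + (e.cost + 1)) := by
  induction hm : μ x using Nat.strong_induction_on generalizing x with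
  | _ m ih =>
    by_cases h0 : e.eval (F x) = 0
    · exact ⟨x, hx, h0, _, .loop_false h0, by omega⟩
    · obtain ⟨y, hy, hlt, k, hk, hkT⟩ := h x hx h0
      obtain ⟨z, hz, hz0, l, hl, hlT⟩ := ih (μ y) (hm ▸ hlt) y hy rfl
      refine ⟨z, hz, hz0, _, .loop_true h0 hk hl, ?_⟩
      have : (μ y + 1) * (e.cost + 1 + T) ≤ m * (e.cost + 1 + T) :=
        Nat.mul_le_mul_right _ (by omega)
      rw [Nat.succ_mul] at this
      omega

/-- A loop with a known number of rounds and known intermediate states. -/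
theorem runs_loop (F : ℕ → Memory) (m : ℕ) {e : Term} {p : Program} {T : ℕ}
    (h : ∀ x < m, e.eval (F x) ≠ 0) (hm : e.eval (F m) = 0)
    (hp : ∀ x < m, p.Runs (F x) (F (x + 1)) T) :
    (loop e p).Runs (F 0) (F m) (m * (e.cost + 1 + T) + (e.cost + 1)) := by
  obtain ⟨y, hy, hy0, hr⟩ := exists_runs_loop F (· ≤ m) (m - ·) (e := e) (p := p) (T := T)
    (fun x hx hx0 => by
      have hlt : x < m := lt_of_le_of_ne hx (by rintro rfl; exact hx0 hm)
      exact ⟨x + 1, hlt, by omega, hp x hlt⟩) 0 (Nat.zero_le m)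
  have : y = m := le_antisymm hy (not_lt.1 fun hlt => h y hlt hy0)
  subst this
  exact hr

end Program

/-! ## Named registers and arrays -/

/-- The registers and arrays used by the program. -/
structure State where
  (N n m q k i j acc p c : ℕ)
  (bits out A R l : ℕ → ℕ)

namespace State

/-- The layout of a state in the memory. -/
def mem (s : State) : Memory where
  reg x := match x with
    | 0 => s.N | 1 => s.n | 2 => s.m | 3 => s.q | 4 => s.k
    | 5 => s.i | 6 => s.j | 7 => s.acc | 8 => s.p | 9 => s.c | _ => 0
  arr a := match a with
    | 0 => s.bits | 1 => s.out | 2 => s.A | 3 => s.R | 4 => s.l | _ => fun _ => 0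

variable (s : State) (v x : ℕ)

@[simp] theorem reg_N : s.mem.reg 0 = s.N := rfl
@[simp] theorem reg_n : s.mem.reg 1 = s.n := rfl
@[simp] theorem reg_m : s.mem.reg 2 = s.m := rfl
@[simp] theorem reg_q : s.mem.reg 3 = s.q := rfl
@[simp] theorem reg_k : s.mem.reg 4 = s.k := rfl
@[simp] theorem reg_i : s.mem.reg 5 = s.i := rfl
@[simp] theorem reg_j : s.mem.reg 6 = s.j := rfl
@[simp] theorem reg_acc : s.mem.reg 7 = s.acc := rfl
@[simp] theorem reg_p : s.mem.reg 8 = s.p := rfl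
@[simp] theorem reg_c : s.mem.reg 9 = s.c := rfl
@[simp] theorem arr_bits : s.mem.arr 0 = s.bits := rfl
@[simp] theorem arr_out : s.mem.arr 1 = s.out := rfl
@[simp] theorem arr_A : s.mem.arr 2 = s.A := rfl
@[simp] theorem arr_R : s.mem.arr 3 = s.R := rfl
@[simp] theorem arr_l : s.mem.arr 4 = s.l := rfl

theorem memory_ext {s t : Memory} (h : ∀ x, s.reg x = t.reg x) (h' : ∀ a, s.arr a = t.arr a) :
    s = t := by
  cases s
  cases t
  simp only [Memory.mk.injEq]
  exact ⟨funext h, funext h'⟩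

theorem setReg_eq {t : Memory} (h : t.reg x = v) (h' : ∀ y, y ≠ x → s.mem.reg y = t.reg y)
    (h'' : ∀ a, s.mem.arr a = t.arr a) : s.mem.setReg x v = t := by
  refine memory_ext (fun y => ?_) h''
  by_cases hy : y = x
  · subst hy
    simp [Memory.setReg, h]
  · simp [Memory.setReg, hy, h' y hy]

-- With memory writes turned into record updates, `simp` can execute loop-free code symbolically.
@[simp] theorem setReg_N : s.mem.setReg 0 v = mem { s with N := v } :=
  setReg_eq s v 0 rfl (fun y hy => by simp only [mem]; split <;> simp_all) fun _ => rfl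
@[simp] theorem setReg_n : s.mem.setReg 1 v = mem { s with n := v } :=
  setReg_eq s v 1 rfl (fun y hy => by simp only [mem]; split <;> simp_all) fun _ => rfl
@[simp] theorem setReg_m : s.mem.setReg 2 v = mem { s with m := v } :=
  setReg_eq s v 2 rfl (fun y hy => by simp only [mem]; split <;> simp_all) fun _ => rfl
@[simp] theorem setReg_q : s.mem.setReg 3 v = mem { s with q := v } :=
  setReg_eq s v 3 rfl (fun y hy => by simp only [mem]; split <;> simp_all) fun _ => rfl
@[simp] theorem setReg_k : s.mem.setReg 4 v = mem { s with k := v } :=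
  setReg_eq s v 4 rfl (fun y hy => by simp only [mem]; split <;> simp_all) fun _ => rfl
@[simp] theorem setReg_i : s.mem.setReg 5 v = mem { s with i := v } :=
  setReg_eq s v 5 rfl (fun y hy => by simp only [mem]; split <;> simp_all) fun _ => rfl
@[simp] theorem setReg_j : s.mem.setReg 6 v = mem { s with j := v } :=
  setReg_eq s v 6 rfl (fun y hy => by simp only [mem]; split <;> simp_all) fun _ => rfl
@[simp] theorem setReg_acc : s.mem.setReg 7 v = mem { s with acc := v } :=
  setReg_eq s v 7 rfl (fun y hy => by simp only [mem]; split <;> simp_all) fun _ => rfl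
@[simp] theorem setReg_p : s.mem.setReg 8 v = mem { s with p := v } :=
  setReg_eq s v 8 rfl (fun y hy => by simp only [mem]; split <;> simp_all) fun _ => rfl
@[simp] theorem setReg_c : s.mem.setReg 9 v = mem { s with c := v } :=
  setReg_eq s v 9 rfl (fun y hy => by simp only [mem]; split <;> simp_all) fun _ => rfl

theorem setArr_eq {t : Memory} {a : ℕ} (h : t.arr a = Function.update (s.mem.arr a) x v)
    (h' : ∀ b, b ≠ a → s.mem.arr b = t.arr b) (h'' : ∀ y, s.mem.reg y = t.reg y) :
    s.mem.setArr a x v = t := by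
  refine memory_ext h'' fun b => ?_
  by_cases hb : b = a
  · subst hb
    simp [Memory.setArr, h]
  · simp [Memory.setArr, hb, h' b hb]

@[simp] theorem setArr_out :
    s.mem.setArr 1 x v = mem { s with out := Function.update s.out x v } :=
  setArr_eq s v x rfl (fun b hb => by simp only [mem]; split <;> simp_all) fun _ => rfl
@[simp] theorem setArr_A :
    s.mem.setArr 2 x v = mem { s with A := Function.update s.A x v } :=
  setArr_eq s v x rfl (fun b hb => by simp only [mem]; split <;> simp_all) fun _ => rfl
@[simp] theorem setArr_R :
    s.mem.setArr 3 x v = mem { s with R := Function.update s.R x v } :=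
  setArr_eq s v x rfl (fun b hb => by simp only [mem]; split <;> simp_all) fun _ => rfl
@[simp] theorem setArr_l :
    s.mem.setArr 4 x v = mem { s with l := Function.update s.l x v } :=
  setArr_eq s v x rfl (fun b hb => by simp only [mem]; split <;> simp_all) fun _ => rfl

/-- The initial state on the input `w`. -/
def init (w : List Bool) : State where
  N := w.length
  n := 0
  m := 0
  q := 0
  k := 0
  i := 0
  j := 0
  acc := 0
  p := 0
  c := 0
  bits x := (w.getD x false).toNat
  out _ := 0
  A _ := 0
  R _ := 0
  l _ := 0

theorem mem_init (w : List Bool) : (init w).mem = Memory.init w := by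
  refine memory_ext (fun x => ?_) fun a => ?_
  · simp only [mem, init, Memory.init]
    split <;> simp_all
  · simp only [mem, init, Memory.init]
    split <;> simp_all

end State

open Term Program

/-! ## The phases of the program -/

/-- Store the length of the first block of ones in `n`, and the beginning of the adjacency
matrices in `m`. -/
def parse : Program :=
  seq (loop (load 0 (reg 1)) (assign 1 (add (reg 1) (const 1))))
    (seq (assign 2 (add (reg 1) (const 1)))
      (seq (loop (load 0 (reg 2)) (assign 2 (add (reg 2) (const 1))))
        (assign 2 (add (reg 2) (const 1)))))

theorem runs_parse (s : State) (hn : s.n = 0) {n τ : ℕ} (h1 : ∀ x < n, s.bits x ≠ 0)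
    (h2 : s.bits n = 0) (h3 : ∀ x < τ, s.bits (n + 1 + x) ≠ 0) (h4 : s.bits (n + 1 + τ) = 0) :
    parse.Runs s.mem { s with n := n, m := n + 1 + τ + 1 }.mem (7 * (n + τ) + 14) := by
  have r1 := runs_loop (fun x => { s with n := x }.mem) n (e := load 0 (reg 1))
    (p := assign 1 (add (reg 1) (const 1))) (T := 4) (by simpa [eval] using h1)
    (by simpa [eval] using h2)
    (fun x _ => runs_of_run_eq rfl (by simp [run, eval]) (by simp [size, cost]))
  have r2 := runs_loop (fun x => { s with n := n, m := n + 1 + x }.mem) τ (e := load 0 (reg 2))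
    (p := assign 2 (add (reg 2) (const 1))) (T := 4) (by simpa [eval] using h3)
    (by simpa [eval] using h4)
    (fun x _ => runs_of_run_eq rfl (by simp [run, eval, add_assoc]) (by simp [size, cost]))
  have hs : ({ s with n := 0 } : State) = s := by rw [← hn]
  simp only [hs] at r1
  refine (r1.seq (.seq (runs_of_run_eq (T := 4) rfl (by simp [run, eval]) (by simp [size, cost]))
    (.seq r2 (runs_of_run_eq (T := 4) rfl (by simp [run, eval]) (by simp [size, cost]))))).mono ?_
  simp only [cost]
  ring_nf
  omega

/-- Run `body` for `i = 0, 1, …, b - 1`. -/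
def forLoop (b : ℕ) (body : Program) : Program :=
  seq (assign 5 (const 0))
    (loop (sub (reg b) (reg 5)) (seq body (assign 5 (add (reg 5) (const 1)))))

/-- `F x` is the state before round `x`. The body ends in `F (x + 1)` with `i` still equal to `x`,
because the counter is incremented only afterwards. -/
theorem runs_forLoop (s : State) (F : ℕ → State) {b B T : ℕ} {body : Program}
    (h0 : { s with i := 0 } = F 0) (hb : ∀ x ≤ B, (F x).mem.reg b = B) (hi : ∀ x, (F x).i = x)
    (h : ∀ x < B, body.Runs (F x).mem { F (x + 1) with i := x }.mem T) :
    (forLoop b body).Runs s.mem (F B).mem (B * (T + 8) + 6) := by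
  refine (Runs.seq (runs_of_run_eq (T := 2) rfl ?_ (by simp [size, cost]))
    (runs_loop (fun x => (F x).mem) B (T := T + 4) (fun x hx => ?_) ?_ fun x hx =>
      (h x hx).seq (runs_of_run_eq rfl ?_ (by simp [size, cost])))).mono ?_
  · simp [run, eval, h0]
  · simp [eval, hb x hx.le, hi]
    omega
  · simp [eval, hb B le_rfl, hi]
  · simp only [run, eval, State.reg_i, State.setReg_i]
    congr 1
    have := hi (x + 1)
    generalize F (x + 1) = G at this ⊢
    rw [← this]
  · simp only [cost]
    ring_nf
    omega

/-- Store the multiples of `n` in `R`, and `n * n` in `q`. -/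
def offsets : Program :=
  forLoop 1 (seq (store 3 (reg 5) (reg 3)) (assign 3 (add (reg 3) (reg 1))))

theorem runs_offsets (s : State) (hq : s.q = 0) :
    offsets.Runs s.mem
      { s with i := s.n, q := s.n * s.n, R := fun x => if x < s.n then x * s.n else s.R x }.mem
      (s.n * 15 + 6) := by
  refine runs_forLoop s
    (fun y => { s with i := y, q := y * s.n, R := fun x => if x < y then x * s.n else s.R x })
    (T := 7) (by simp [hq]) (fun x _ => by simp) (fun _ => rfl) fun y hy =>
      runs_of_run_eq rfl ?_ (by simp [size, cost])
  simp only [run, eval, State.reg_i, State.reg_q, State.reg_n, State.setArr_R, State.setReg_q]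
  congr 2
  · ring
  · funext x
    simp only [Function.update_apply]
    grind

/-- Store `N * N` in `k`. -/
def scale : Program := forLoop 0 (assign 4 (add (reg 4) (reg 0)))

theorem runs_scale (s : State) (hk : s.k = 0) :
    scale.Runs s.mem { s with i := s.N, k := s.N * s.N }.mem (s.N * 12 + 6) := by
  refine runs_forLoop s (fun y => { s with i := y, k := y * s.N })
    (T := 4) (by simp [hk]) (fun x _ => by simp) (fun _ => rfl) fun y hy =>
      runs_of_run_eq rfl ?_ (by simp [size, cost])
  simp [run, eval, Nat.succ_mul]

/-- Store `k` times the sum of the adjacency matrices in `A`. -/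
def sumMatrices : Program :=
  forLoop 3 (seq (assign 8 (add (reg 2) (reg 5)))
    (seq (loop (sub (reg 0) (reg 8))
        (seq (cond (load 0 (reg 8)) (assign 7 (add (reg 7) (reg 4))) skip)
          (assign 8 (add (reg 8) (reg 3)))))
      (seq (store 2 (reg 5) (reg 7)) (seq (assign 7 (const 0)) (assign 8 (const 0))))))

theorem runs_sumMatrices (s : State) (hacc : s.acc = 0) (hp : s.p = 0) {τ : ℕ}
    (hN : s.N = s.m + τ * s.q) :
    sumMatrices.Runs s.mem
      { s with
        i := s.q,
        A := fun x => if x < s.q then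
          ∑ t ∈ Finset.range τ, if s.bits (s.m + x + t * s.q) = 0 then 0 else s.k else s.A x }.mem
      (s.q * (τ * 16 + 23) + 6) := by
  set f : ℕ → ℕ → ℕ := fun x τ =>
    ∑ t ∈ Finset.range τ, if s.bits (s.m + x + t * s.q) = 0 then 0 else s.k with hf
  refine runs_forLoop s
    (fun y => { s with i := y, A := fun x => if x < y then f x τ else s.A x })
    (T := τ * 16 + 15) (by simp) (fun x _ => by simp) (fun _ => rfl) fun y hy => ?_
  set A : ℕ → ℕ := fun x => if x < y then f x τ else s.A x
  have hloop := runs_loop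
    (fun t => { s with i := y, A := A, acc := f y t, p := s.m + y + t * s.q }.mem) τ
    (e := sub (reg 0) (reg 8))
    (p := seq (cond (load 0 (reg 8)) (assign 7 (add (reg 7) (reg 4))) skip)
          (assign 8 (add (reg 8) (reg 3)))) (T := 12)
    -- Entries at the same position of consecutive matrices are `q` apart and the last matrix ends
    -- at `N`, so, as `y < q`, the pointer passes `N` after exactly `τ` rounds.
    (fun t ht => by
      simp only [eval, State.reg_N, State.reg_p, hN]
      have : (t + 1) * s.q ≤ τ * s.q := Nat.mul_le_mul_right _ ht
      rw [Nat.succ_mul] at this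
      omega)
    (by
      simp only [eval, State.reg_N, State.reg_p, hN]
      omega)
    (fun t ht => runs_of_run_eq rfl (by
      simp only [run, eval, State.reg_p, State.arr_bits, State.reg_acc, State.reg_k,
        State.setReg_acc]
      split_ifs with h0 <;> simp only [add_assoc] at h0 <;>
        simp [hf, Finset.sum_range_succ, h0, Nat.succ_mul, add_assoc]) (by simp [size, cost]))
  refine (Runs.seq (runs_of_run_eq (T := 4) rfl ?_ (by simp [size, cost]))
    (hloop.seq (runs_of_run_eq (T := 7) rfl ?_ (by simp [size, cost])))).mono ?_
  · simp [run, eval, hf, hacc]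
  · simp only [run, eval, State.reg_i, State.reg_acc, State.setArr_A, State.setReg_acc,
      State.setReg_p]
    congr 2
    · exact hacc.symm
    · exact hp.symm
    · funext x
      simp only [Function.update_apply, A]
      grind
  · simp only [cost]
    ring_nf
    omega

/-- Store the sums of the rows of `A` in `l`. -/
def rowSums : Program :=
  forLoop 1 (seq (loop (sub (reg 1) (reg 6))
      (seq (assign 7 (add (reg 7) (load 2 (add (load 3 (reg 5)) (reg 6)))))
        (assign 6 (add (reg 6) (const 1)))))
    (seq (store 4 (reg 5) (reg 7)) (seq (assign 7 (const 0)) (assign 6 (const 0)))))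

theorem runs_rowSums (s : State) (hacc : s.acc = 0) (hj : s.j = 0) :
    rowSums.Runs s.mem
      { s with
        i := s.n,
        l := fun x => if x < s.n then
          ∑ y ∈ Finset.range s.n, s.A (s.R x + y) else s.l x }.mem
      (s.n * (s.n * 16 + 19) + 6) := by
  set f : ℕ → ℕ → ℕ := fun x z => ∑ y ∈ Finset.range z, s.A (s.R x + y) with hf
  refine runs_forLoop s
    (fun y => { s with i := y, l := fun x => if x < y then f x s.n else s.l x })
    (T := s.n * 16 + 11) (by simp) (fun x _ => by simp) (fun _ => rfl) fun y hy => ?_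
  set l : ℕ → ℕ := fun x => if x < y then f x s.n else s.l x
  have hloop := runs_loop
    (fun z => { s with i := y, l := l, acc := f y z, j := z }.mem) s.n
    (e := sub (reg 1) (reg 6))
    (p := seq (assign 7 (add (reg 7) (load 2 (add (load 3 (reg 5)) (reg 6)))))
        (assign 6 (add (reg 6) (const 1)))) (T := 12)
    (fun t ht => by
      simp only [eval, State.reg_n, State.reg_j]
      omega)
    (by simp [eval])
    (fun t ht => runs_of_run_eq rfl (by simp [run, eval, hf, Finset.sum_range_succ])
      (by simp [size, cost]))
  have h0 : ({ s with i := y, l := l, acc := f y 0, j := 0 } : State) =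
      { s with i := y, l := l } := by
    simp [hf, hacc, hj]
  simp only [h0] at hloop
  refine (hloop.seq (runs_of_run_eq (T := 7) rfl ?_ (by simp [size, cost]))).mono ?_
  · simp only [run, eval, State.reg_i, State.reg_acc, State.setArr_l, State.setReg_acc,
      State.setReg_j]
    congr 2
    · exact hj.symm
    · exact hacc.symm
    · funext x
      simp only [Function.update_apply, l]
      grind
  · simp only [cost]
    ring_nf
    omega

/-- Store the maximum of `l` in `c`. -/
def maxLoad : Program :=
  forLoop 1 (assign 9 (add (reg 9) (sub (load 4 (reg 5)) (reg 9))))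

theorem runs_maxLoad (s : State) (hc : s.c = 0) :
    maxLoad.Runs s.mem { s with i := s.n, c := (Finset.range s.n).sup s.l }.mem
      (s.n * 15 + 6) := by
  refine runs_forLoop s (fun y => { s with i := y, c := (Finset.range y).sup s.l })
    (T := 7) (by simp [hc]) (fun x _ => by simp) (fun _ => rfl) fun y hy =>
      runs_of_run_eq rfl ?_ (by simp [size, cost])
  simp only [run, eval, State.reg_c, State.reg_i, State.arr_l, State.setReg_c,
    Finset.range_add_one, Finset.sup_insert]
  congr 2
  rw [add_tsub_eq_max]
  exact max_comm _ _

/-- Write the characteristic vector of the set of all `x` with `c ≤ l x` into the output. -/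
def output : Program :=
  seq (forLoop 1 (store 1 (reg 5) (sub (const 1) (sub (reg 9) (load 4 (reg 5))))))
    (assign 0 (reg 1))

/-- Truncated subtraction makes `1 - (c - l x)` the indicator of `c ≤ l x`. -/
theorem runs_output (s : State) :
    output.Runs s.mem { s with
        i := s.n,
        N := s.n,
        out := fun x => if x < s.n then 1 - (s.c - s.l x) else s.out x }.mem
      (s.n * 16 + 8) := by
  refine Runs.seq (T := s.n * 16 + 6) (U := 2) (runs_forLoop s
    (fun y => { s with
      i := y, out := fun x => if x < y then 1 - (s.c - s.l x) else s.out x })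
    (T := 8) (by simp) (fun x _ => by simp) (fun _ => rfl) fun y hy =>
      runs_of_run_eq rfl ?_ (by simp [size, cost]))
      (runs_of_run_eq rfl ?_ (by simp [size, cost]))
  · simp only [run, eval, State.reg_c, State.reg_i, State.arr_l, State.setArr_out]
    congr 2
    funext x
    simp only [Function.update_apply]
    grind
  · simp [run, eval]

/-! ### Local search for a balanced split -/

/-- Move one unit from `i` to `j` if `A i j` is positive and the load of `i` exceeds that of `j` by
at least `2`, and start again; go on to the next pair `(i, j)` otherwise. -/
def localSearchStep : Program :=
  cond (sub (reg 1) (reg 6))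
    -- The term has the form `x - (x - y) = min x y`, which is nonzero exactly when both conditions
    -- for a move hold.
    (cond (sub (load 2 (add (load 3 (reg 5)) (reg 6)))
        (sub (load 2 (add (load 3 (reg 5)) (reg 6)))
          (sub (load 4 (reg 5)) (add (load 4 (reg 6)) (const 1)))))
      (seq (store 2 (add (load 3 (reg 5)) (reg 6))
            (sub (load 2 (add (load 3 (reg 5)) (reg 6))) (const 1)))
        (seq (store 2 (add (load 3 (reg 6)) (reg 5))
            (add (load 2 (add (load 3 (reg 6)) (reg 5))) (const 1)))
          (seq (store 4 (reg 5) (sub (load 4 (reg 5)) (const 1)))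
            (seq (store 4 (reg 6) (add (load 4 (reg 6)) (const 1)))
              (seq (assign 5 (const 0)) (assign 6 (const 0)))))))
      (assign 6 (add (reg 6) (const 1))))
    (seq (assign 5 (add (reg 5) (const 1))) (assign 6 (const 0)))

/-- Move units downhill until no move is possible. -/
def localSearch : Program :=
  seq (assign 5 (const 0)) (loop (sub (reg 1) (reg 5)) localSearchStep)

theorem mul_add_inj_of_lt {n a b c d : ℕ} (hb : b < n) (hd : d < n) :
    a * n + b = c * n + d ↔ a = c ∧ b = d := by
  refine ⟨fun h => ?_, by rintro ⟨rfl, rfl⟩; rfl⟩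
  have hac : a = c := by
    have := congrArg (· / n) h
    simpa [Nat.add_div_of_dvd_right, Nat.mul_div_cancel _ (Nat.zero_lt_of_lt hb),
      Nat.div_eq_of_lt hb, Nat.div_eq_of_lt hd] using this
  subst hac
  exact ⟨rfl, by omega⟩

theorem exists_runs_localSearch (s : State) {n : ℕ} (hn : s.n = n) (hj : s.j = 0)
    (hR : ∀ x < n, s.R x = x * n) {w : Fin n → Fin n → ℕ}
    (hs : IsLoadSplit w (fun a b => s.A (a * n + b)) fun a => s.l a) :
    ∃ A l : ℕ → ℕ, IsLoadSplit w (fun a b => A (a * n + b)) (fun a => l a) ∧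
      (∀ a b : Fin n, A (a * n + b) ≠ 0 → l a ≤ l b + 1) ∧
      (∑ a : Fin n, l a ^ 2) ≤ ∑ a : Fin n, s.l a ^ 2 ∧
      localSearch.Runs s.mem { s with i := n, A := A, l := l }.mem
        (((∑ a : Fin n, s.l a ^ 2) * (n + 2) ^ 2 + n * (n + 1) + n) * 90 + 10) := by
  subst hn
  have key := exists_runs_loop (σ := (ℕ → ℕ) × (ℕ → ℕ) × ℕ × ℕ)
    (fun x => { s with A := x.1, l := x.2.1, i := x.2.2.1, j := x.2.2.2 }.mem)
    -- All pairs lexicographically before `(i, j)` are balanced, so a completed scan certifies the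
    -- whole split.
    (fun x => IsLoadSplit w (fun a b => x.1 (a * s.n + b)) (fun a => x.2.1 a) ∧
      x.2.2.1 ≤ s.n ∧ x.2.2.2 ≤ s.n ∧ (x.2.2.1 = s.n → x.2.2.2 = 0) ∧
      (∀ a b : Fin s.n, (a < x.2.2.1 ∨ a = x.2.2.1 ∧ b < x.2.2.2) →
        x.1 (a * s.n + b) ≠ 0 → x.2.1 a ≤ x.2.1 b + 1) ∧
      (∑ a : Fin s.n, x.2.1 a ^ 2) ≤ ∑ a : Fin s.n, s.l a ^ 2)
    -- A lexicographic measure: the squared loads first, then what remains of the scan, which is at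
    -- most `n * (n + 1) + n < (n + 2) ^ 2`. A move may therefore restart the scan.
    (fun x => (∑ a : Fin s.n, x.2.1 a ^ 2) * (s.n + 2) ^ 2 + (s.n - x.2.2.1) * (s.n + 1) +
      (s.n - x.2.2.2))
    (e := sub (reg 1) (reg 5))
    (p := localSearchStep) (T := 86) ?_
    (s.A, s.l, 0, 0) ⟨hs, by simp, by simp, by simp, by simp, le_rfl⟩
  · obtain ⟨⟨A, l, i, j⟩, ⟨h1, h2, h3, h4, h5, h6⟩, h0, hr⟩ := key
    simp only [eval, State.reg_n, State.reg_i] at h0 h1 h2 h3 h4 h5 h6 hr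
    obtain rfl : i = s.n := by omega
    obtain rfl : j = 0 := h4 rfl
    refine ⟨A, l, h1, fun a b => h5 a b (.inl a.2), h6, ?_⟩
    have hinit : (assign 5 (const 0)).Runs s.mem { s with i := 0, j := 0 }.mem 2 :=
      runs_of_run_eq rfl (by simp [run, eval, ← hj]) (by simp [size, cost])
    have hfinal : ({ s with A := A, l := l, i := s.n, j := 0 } : State) =
        { s with A := A, l := l, i := s.n } := by rw [← hj]
    rw [hfinal] at hr
    refine (hinit.seq hr).mono ?_
    simp only [cost, Nat.sub_zero]
    omega
  · rintro ⟨A, l, i, j⟩ ⟨h1, h2, h3, h4, h5, h6⟩ h0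
    simp only [eval, State.reg_n, State.reg_i] at h0 h1 h2 h3 h4 h5 h6
    have hi : i < s.n := by omega
    by_cases hjn : j < s.n
    swap
    · refine ⟨(A, l, i + 1, 0), ⟨h1, hi, Nat.zero_le _, fun _ => rfl, fun a b hab => ?_, h6⟩, ?_,
        runs_of_run_eq rfl ?_ (by simp [localSearchStep, size, cost])⟩
      · refine h5 a b ?_
        have := b.2
        dsimp only at hab
        omega
      · have : (s.n - i) * (s.n + 1) = (s.n - (i + 1)) * (s.n + 1) + (s.n + 1) := by
          rw [← Nat.succ_mul]
          congr 1
          omega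
        dsimp only
        omega
      · have : s.n - j = 0 := by omega
        simp [localSearchStep, run, eval, this]
    have hjn' : s.n - j ≠ 0 := by omega
    by_cases hmov : A (i * s.n + j) ≠ 0 ∧ l j + 2 ≤ l i
    swap
    · refine ⟨(A, l, i, j + 1), ⟨h1, h2, hjn, fun h => absurd h hi.ne, fun a b hab => ?_, h6⟩, ?_,
        runs_of_run_eq rfl ?_ (by simp [localSearchStep, size, cost])⟩
      · by_cases hab' : (a : ℕ) = i ∧ (b : ℕ) = j
        · rw [hab'.1, hab'.2]
          dsimp only
          omega
        · refine h5 a b ?_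
          dsimp only at hab
          omega
      · dsimp only
        omega
      · have : A (i * s.n + j) - (A (i * s.n + j) - (l i - (l j + 1))) = 0 := by omega
        simp [localSearchStep, run, eval, hjn', hR i hi, this]
    obtain ⟨hA, hl⟩ := hmov
    have hij : i ≠ j := by
      rintro rfl
      omega
    -- The cells of `(i, j)` and `(j, i)` differ, so the two updates do not interfere.
    have hne : j * s.n + i ≠ i * s.n + j := by
      rw [Ne, mul_add_inj_of_lt hi hjn]
      omega
    set A₁ := Function.update (Function.update A (i * s.n + j) (A (i * s.n + j) - 1))
      (j * s.n + i) (A (j * s.n + i) + 1) with hA₁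
    set l₁ := Function.update (Function.update l i (l i - 1)) j (l j + 1) with hl₁
    have e4 : l₁ i + 1 = l i := by
      simp only [hl₁, Function.update_apply, hij, if_true, if_false]
      omega
    have e5 : l₁ j = l j + 1 := by simp [hl₁]
    have e6 : ∀ a : Fin s.n, a ≠ ⟨i, hi⟩ → a ≠ ⟨j, hjn⟩ → l₁ a = l a := by
      intro a ha hb
      simp only [Ne, Fin.ext_iff] at ha hb
      simp [hl₁, ha, hb]
    have hlt := sum_sq_lt_of_move (l := fun a : Fin s.n => l a) (l' := fun a : Fin s.n => l₁ a)
      (a := ⟨i, hi⟩) (b := ⟨j, hjn⟩) hl e4 e5 e6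
    refine ⟨(A₁, l₁, 0, 0), ⟨h1.move (a := ⟨i, hi⟩) (b := ⟨j, hjn⟩) (by simpa using hij) ?_ ?_ ?_
      e4 e5 e6, Nat.zero_le _, Nat.zero_le _, fun _ => rfl, by simp, hlt.le.trans h6⟩, ?_,
        runs_of_run_eq rfl ?_ (by simp [localSearchStep, size, cost])⟩
    · simp only [hA₁, Function.update_apply, hne.symm, if_true, if_false]
      omega
    · simp [hA₁]
    · intro a b hab hba
      simp only [Fin.ext_iff] at hab hba
      simp only [hA₁, Function.update_apply, mul_add_inj_of_lt b.2 hi, mul_add_inj_of_lt b.2 hjn,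
        hab, hba, if_false]
    · have h7 := Nat.mul_le_mul_right ((s.n + 2) ^ 2) hlt
      have h8 : s.n * (s.n + 1) + s.n < (s.n + 2) ^ 2 := by nlinarith
      rw [Nat.succ_mul] at h7
      simp only [Nat.sub_zero]
      omega
    · have : A (i * s.n + j) - (A (i * s.n + j) - (l i - (l j + 1))) ≠ 0 := by omega
      simp [localSearchStep, run, eval, hjn', hR i hi, hR j hjn, this, hne, hij.symm, hA₁, hl₁]

/-! ### Search for a gap among the loads -/

/-- If `l i = c - 1`, decrease `c` and start again; go on to the next `i` otherwise. -/
def thresholdStep : Program :=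
  -- The sum of both truncated differences vanishes only if `l i + 1 = c`.
  cond (add (sub (add (load 4 (reg 5)) (const 1)) (reg 9))
      (sub (reg 9) (add (load 4 (reg 5)) (const 1))))
    (assign 5 (add (reg 5) (const 1)))
    (seq (assign 9 (sub (reg 9) (const 1))) (assign 5 (const 0)))

/-- Decrease `c` until there is no `i` with `l i = c - 1`. -/
def threshold : Program :=
  seq (assign 5 (const 0)) (loop (sub (reg 1) (reg 5)) thresholdStep)

/-- Each decrease of `c` is triggered by a vertex whose load is the new value of `c`, so no value is
skipped on the way down. -/
theorem exists_runs_threshold (s : State) (hc : ∃ a < s.n, s.l a = s.c) :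
    ∃ c ≤ s.c, (∀ x, c ≤ x → x ≤ s.c → ∃ a < s.n, s.l a = x) ∧ (∀ a < s.n, s.l a + 1 ≠ c) ∧
      threshold.Runs s.mem { s with i := s.n, c := c }.mem
        ((s.c * (s.n + 1) + s.n) * 30 + 10) := by
  have key := exists_runs_loop (σ := ℕ × ℕ) (fun x => { s with c := x.1, i := x.2 }.mem)
    (fun x => x.1 ≤ s.c ∧ x.2 ≤ s.n ∧ (∀ y, x.1 ≤ y → y ≤ s.c → ∃ a < s.n, s.l a = y) ∧
      ∀ a < x.2, s.l a + 1 ≠ x.1)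
    (fun x => x.1 * (s.n + 1) + (s.n - x.2))
    (e := sub (reg 1) (reg 5))
    (p := thresholdStep) (T := 26) ?_ (s.c, 0)
      ⟨le_rfl, Nat.zero_le _, fun y h1 h2 => le_antisymm h1 h2 ▸ hc, by simp⟩
  · obtain ⟨⟨c, i⟩, ⟨h1, h2, h3, h4⟩, h0, hr⟩ := key
    simp only [eval, State.reg_n, State.reg_i] at h0 h1 h2 h3 h4 hr
    obtain rfl : i = s.n := by omega
    refine ⟨c, h1, h3, h4, (Runs.seq (T := 2) (runs_of_run_eq rfl ?_ (by simp [size, cost]))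
      hr).mono ?_⟩
    · simp [run, eval]
    · simp only [cost]
      omega
  · rintro ⟨c, i⟩ ⟨h1, h2, h3, h4⟩ h0
    simp only [eval, State.reg_n, State.reg_i] at h0 h1 h2 h3 h4
    have hi : i < s.n := by omega
    by_cases h : s.l i + 1 = c
    · refine ⟨(c - 1, 0), ⟨(Nat.sub_le _ _).trans h1, Nat.zero_le _, fun y hy hy' => ?_,
        by simp⟩, ?_, runs_of_run_eq rfl ?_ (by simp [thresholdStep, size, cost])⟩
      · by_cases hyc : c ≤ y
        · exact h3 y hyc hy'
        · dsimp only at hy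
          exact ⟨i, hi, by omega⟩
      · subst h
        dsimp only
        rw [Nat.succ_sub_one, Nat.succ_mul]
        omega
      · simp [thresholdStep, run, eval, h]
    · refine ⟨(c, i + 1), ⟨h1, hi, h3, fun a ha => ?_⟩, ?_,
        runs_of_run_eq rfl ?_ (by simp [thresholdStep, size, cost])⟩
      · dsimp only at ha
        rcases Nat.lt_succ_iff_lt_or_eq.1 ha with ha | rfl
        · exact h4 a ha
        · exact h
      · dsimp only
        omega
      · have : ¬(s.l i + 1 - c = 0 ∧ c - (s.l i + 1) = 0) := by omega
        simp [thresholdStep, run, eval, this]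

/-! ### The complete program and its time bound -/

/-- A program for BFF-aa. -/
def bffAA : Program :=
  seq parse (seq offsets (seq scale (seq sumMatrices (seq rowSums (seq localSearch
    (seq maxLoad (seq threshold output)))))))

open Polynomial in
/-- A bound for the running time of `bffAA`. -/
noncomputable def bffAATime : Polynomial ℕ :=
  (7 * (X + X) + 14) + ((X * 15 + 6) + ((X * 12 + 6) + ((X * (X * 16 + 23) + 6) +
    ((X * (X * 16 + 19) + 6) + (((X ^ 9 * (X + 2) ^ 2 + X * (X + 1) + X) * 90 + 10) +
      ((X * 15 + 6) + (((X ^ 9 * (X + 1) + X) * 30 + 10) + (X * 16 + 8))))))))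

theorem exists_optimal_runs_bffAA {n τ : ℕ} (hn : 0 < n) (hτ : 0 < τ)
    (𝒢 : GraphHistory (Fin n) τ) :
    ∃ S : Finset (Fin n), 𝒢.IsOptimalAA S ∧ ∃ s : State,
      bffAA.Runs (Memory.init 𝒢.encode) s.mem (bffAATime.eval 𝒢.encode.length) ∧
        s.N = n ∧ ∀ i : Fin n, s.out i = if i ∈ S then 1 else 0 := by
  classical
  have hlen := 𝒢.length_encode
  set N := 𝒢.encode.length with hN
  have hnN : n ≤ N := by omega
  have hτN : τ ≤ N := by omega
  -- The presence of at least one adjacency matrix (`0 < τ`) is needed here.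
  have hqN : n * n ≤ N := by nlinarith
  have hnτN : n + τ ≤ N := by omega
  let s₀ := State.init 𝒢.encode
  let s₁ : State := { s₀ with n := n, m := n + 1 + τ + 1 }
  have r₁ : parse.Runs s₀.mem s₁.mem _ := runs_parse s₀ rfl (n := n) (τ := τ)
    (fun x hx => by simp only [s₀, State.init, 𝒢.getD_encode_of_lt hx]; decide)
    (by simp only [s₀, State.init, 𝒢.getD_encode_nodes]; decide)
    (fun x hx => by simp only [s₀, State.init, 𝒢.getD_encode_snapshots_of_lt hx]; decide)
    (by simp only [s₀, State.init, 𝒢.getD_encode_snapshots]; decide)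
  let s₂ : State := { s₁ with
    i := n, q := n * n, R := fun x => if x < n then x * n else s₁.R x }
  have r₂ : offsets.Runs s₁.mem s₂.mem _ := runs_offsets s₁ rfl
  let s₃ : State := { s₂ with i := N, k := N * N }
  have r₃ : scale.Runs s₂.mem s₃.mem _ := runs_scale s₂ rfl
  obtain ⟨A, hA, r₄⟩ : ∃ A : ℕ → ℕ,
      (∀ a b : Fin n, A (a * n + b) = N * N * 𝒢.weight a b) ∧
      sumMatrices.Runs s₃.mem { s₃ with i := n * n, A := A }.mem _ := by
    refine ⟨_, fun a b => ?_, runs_sumMatrices s₃ rfl rfl (τ := τ) hlen⟩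
    have hab : (a * n + b : ℕ) < n * n := by nlinarith [a.2, b.2]
    rw [if_pos (show (a * n + b : ℕ) < s₃.q from hab), Finset.sum_range, GraphHistory.weight,
      Finset.mul_sum]
    refine Finset.sum_congr rfl fun t _ => ?_
    have hbit : s₃.bits (s₃.m + (a * n + b) + t * s₃.q) =
        (decide ((𝒢.snapshot t).Adj a b)).toNat := by
      rw [← 𝒢.getD_encode_adj, add_assoc, add_comm (a * n + b : ℕ)]
      rfl
    rw [hbit]
    by_cases h : (𝒢.snapshot t).Adj a b <;> simp [h, s₃]
  let s₄ : State := { s₃ with i := n * n, A := A }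
  obtain ⟨l, hl, r₅⟩ : ∃ l : ℕ → ℕ,
      (∀ a : Fin n, l a = ∑ b : Fin n, A (a * n + b)) ∧
      rowSums.Runs s₄.mem { s₄ with i := n, l := l }.mem _ := by
    refine ⟨_, fun a => ?_, runs_rowSums s₄ rfl rfl⟩
    rw [if_pos (show (a : ℕ) < s₄.n from a.2), Finset.sum_range]
    refine Finset.sum_congr rfl fun b _ => ?_
    rw [show s₄.R a = a * n from if_pos a.2]
  let s₅ : State := { s₄ with i := n, l := l }
  -- The factor 2 makes the even split integral: the scaled symmetric matrix is itself the initial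
  -- split.
  have hsplit : IsLoadSplit (fun a b : Fin n => 2 * (N * N * 𝒢.weight a b))
      (fun a b => s₅.A (a * n + b)) (fun a => s₅.l a) :=
    ⟨fun a b => by
      change A _ + A _ = _
      rw [hA, hA, 𝒢.weight_comm b a, two_mul], hl⟩
  obtain ⟨A', l', hsplit', hbal, hsq, r₆⟩ := exists_runs_localSearch s₅ (n := n) rfl rfl
    (fun x hx => if_pos hx) hsplit
  -- At most `N` entries, each the product of the scale `N ^ 2` and a weight at most `τ ≤ N`.
  have hle : ∀ a : Fin n, l a ≤ N ^ 4 := fun a => by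
    rw [hl]
    calc ∑ b : Fin n, A (a * n + b) ≤ ∑ b : Fin n, N * N * N := by
          refine Finset.sum_le_sum fun b _ => ?_
          rw [hA]
          exact Nat.mul_le_mul_left _ ((𝒢.weight_le a b).trans hτN)
      _ = n * (N * N * N) := by simp
      _ ≤ N * (N * N * N) := by gcongr
      _ = N ^ 4 := by ring
  have hsum : ∑ a : Fin n, s₅.l a ^ 2 ≤ N ^ 9 := by
    calc ∑ a : Fin n, l a ^ 2 ≤ ∑ a : Fin n, (N ^ 4) ^ 2 :=
          Finset.sum_le_sum fun a _ => Nat.pow_le_pow_left (hle a) 2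
      _ = n * (N ^ 4) ^ 2 := by simp
      _ ≤ N * (N ^ 4) ^ 2 := by gcongr
      _ = N ^ 9 := by ring
  let s₆ : State := { s₅ with i := n, A := A', l := l' }
  set L := (Finset.range n).sup l' with hL
  let s₇ : State := { s₆ with i := n, c := L }
  have r₇ : maxLoad.Runs s₆.mem s₇.mem _ := runs_maxLoad s₆ rfl
  obtain ⟨a₀, ha₀, hmax⟩ := Finset.exists_mem_eq_sup (Finset.range n)
    (Finset.nonempty_range_iff.2 hn.ne') l'
  rw [Finset.mem_range] at ha₀
  obtain ⟨c, hcL, hlev, hgap, r₈⟩ := exists_runs_threshold s₇ ⟨a₀, ha₀, hmax.symm⟩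
  let s₈ : State := { s₇ with i := n, c := c }
  let s₉ : State := { s₈ with
    i := n, N := n, out := fun x => if x < n then 1 - (c - l' x) else s₈.out x }
  have r₉ : output.Runs s₈.mem s₉.mem _ := runs_output s₈
  have hLN : L ≤ N ^ 9 := by
    rw [hL, hmax]
    -- Final loads are bounded through their squares, whose sum the local search never increases.
    refine le_trans (Nat.le_self_pow two_ne_zero _) (le_trans ?_ (hsq.trans hsum))
    exact Finset.single_le_sum (f := fun a : Fin n => l' a ^ 2) (fun _ _ => Nat.zero_le _)
      (Finset.mem_univ ⟨a₀, ha₀⟩)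
  refine ⟨Finset.univ.filter fun a : Fin n => c ≤ l' a,
    𝒢.isOptimalAA_of_densest ⟨⟨a₀, ha₀⟩, ?_⟩ fun T hT => ?_, s₉, ?_, rfl, fun i => ?_⟩
  · simp only [Finset.mem_filter, Finset.mem_univ, true_and]
    exact hcL.trans hmax.le
  · refine hsplit'.densest (c := c) (L := L) ?_ hbal
      (fun i => Finset.le_sup (Finset.mem_range.2 i.2)) (fun x h1 h2 => ?_)
      (fun i => hgap i i.2) _ (by simp) T hT
    · rw [Fintype.card_fin]
      -- The scale `N * N` is large enough because `n * n ≤ N` and `n ≤ N`.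
      calc n ^ 3 = n * n * n := by ring
        _ ≤ N * N := by gcongr
    · obtain ⟨a, ha, ha'⟩ := hlev x h1 h2
      exact ⟨⟨a, ha⟩, ha'⟩
  · rw [← State.mem_init]
    simp only [bffAATime, Polynomial.eval_add, Polynomial.eval_mul, Polynomial.eval_pow,
      Polynomial.eval_X, Polynomial.eval_ofNat, Polynomial.eval_one]
    refine (r₁.mono ?_).seq ((r₂.mono ?_).seq ((r₃.mono ?_).seq ((r₄.mono ?_).seq
      ((r₅.mono ?_).seq ((r₆.mono ?_).seq ((r₇.mono ?_).seq ((r₈.mono ?_).seq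
        (r₉.mono ?_))))))))
    · omega
    · change n * 15 + 6 ≤ N * 15 + 6
      omega
    · exact le_rfl
    · change n * n * (τ * 16 + 23) + 6 ≤ N * (N * 16 + 23) + 6
      gcongr
    · change n * (n * 16 + 19) + 6 ≤ N * (N * 16 + 19) + 6
      gcongr
    · gcongr
    · change n * 15 + 6 ≤ N * 15 + 6
      omega
    · change (L * (n + 1) + n) * 30 + 10 ≤ (N ^ 9 * (N + 1) + N) * 30 + 10
      gcongr
    · change n * 16 + 8 ≤ N * 16 + 8
      omega
  · change (if (i : ℕ) < n then 1 - (c - l' i) else _) = _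
    simp only [i.2, if_true, Finset.mem_filter, Finset.mem_univ, true_and]
    split_ifs <;> omega

end RAM

theorem proposition2 :
    ∃ (P : RAM.Program) (time : Polynomial ℕ),
      ∀ (n τ : ℕ), 0 < n → 0 < τ → ∀ 𝒢 : GraphHistory (Fin n) τ,
        ∃ S : Finset (Fin n), 𝒢.IsOptimalAA S ∧
          P.OutputsInTime 𝒢.encode (encodeNodes S) (time.eval 𝒢.encode.length) := by
  refine ⟨RAM.bffAA, RAM.bffAATime, fun n τ hn hτ 𝒢 => ?_⟩
  obtain ⟨S, hS, s, ⟨k, hk, hkT⟩, hN, hout⟩ := RAM.exists_optimal_runs_bffAA hn hτ 𝒢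
  refine ⟨S, hS, s.mem, k, hk, hkT, ?_, fun i hi => ?_⟩
  · simp [encodeNodes, hN]
  · have hi' : i < n := by simpa [encodeNodes] using hi
    have := hout ⟨i, hi'⟩
    by_cases h : (⟨i, hi'⟩ : Fin n) ∈ S <;> simp_all [encodeNodes]
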